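/- Let $G=(V,E)$ be a finite simple graph with minimum degree at least $2$. Algorithm PLG (Permute, LP, Greedy) runs on $G$ as follows. (1) Choose a uniformly random ordering $\pi$ of $V$. For $i\ge 1$ let $L_i$ be the set of vertices $v$ such that exactly $i-1$ neighbours of $v$ appear before $v$ in $\pi$, and let $G_3$ be the subgraph of $G$ induced on $L_1\cup L_2\cup L_3$. (2) Find an optimal solution $x$ with all $x_v\in\{0,\tfrac12,1\}$ of the linear program: maximize $\sum_{v\in V(G_3)}x_v$ subject to $x_u+x_v\le 1$ for every edge $uv$ of $G_3$ and $0\le x_v\le 1$ for every vertex $v$ of $G_3$. Put all vertices with $x_v=1$ in the output and discard all vertices with $x_v=0$. (3) Run the greedy algorithm on the subgraph induced on the remaining vertices of $G_3$ (those with $x_v=\tfrac12$): repeatedly add a vertex of minimum degree in the current graph to the output and delete it together with its neighbours, until no vertex remains. Then, for every ordering $\pi$, the algorithm can be carried out, and whatever optimal half-integral solution is chosen in (2) and however ties are broken in (3), its output is an independent set of $G$. Moreover, for every (possibly randomized) rule for making these choices, which may depend on $\pi$, the random output $S$ satisfies, for every independent set $I$ of $G$, $$\mathbb E\,|S|\;\ge\;\frac{15}{7}\sum_{v\in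 I}\frac{1}{d(v)+1},$$ where $d(v)$ is the degree of $v$ in $G$. -/

import Mathlib

open MeasureTheory

namespace PLG

variable {V : Type*} [Fintype V] [DecidableEq V]

/-- An ordering of the vertices: `π v` is the position of `v`. -/
abbrev VertexOrder (V : Type*) [Fintype V] : Type _ := V ≃ Fin (Fintype.card V)

/-- The layer `L_i`: the vertices having exactly `i - 1` neighbours that appear before them
in the ordering (layers are numbered from `1`). -/
def layer (G : SimpleGraph V) [DecidableRel G.Adj] (π : VertexOrder V) (i : ℕ) : Finset V :=
  {v | ((G.neighborFinset v).filter (fun u => π u < π v)).card + 1 = i}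

/-- The vertex set `L_1 ∪ ⋯ ∪ L_k` of the induced subgraph `G_k`. -/
def firstLayers (G : SimpleGraph V) [DecidableRel G.Adj] (π : VertexOrder V) (k : ℕ) :
    Finset V :=
  (Finset.Icc 1 k).biUnion (layer G π)

/-- `x` is feasible for the LP relaxation of maximum independent set on the induced subgraph
`G[W]`. Only the values of `x` on `W` matter. -/
def LPFeasible (G : SimpleGraph V) (W : Finset V) (x : V → ℝ) : Prop :=
  (∀ v ∈ W, 0 ≤ x v ∧ x v ≤ 1) ∧ ∀ u ∈ W, ∀ v ∈ W, G.Adj u v → x u + x v ≤ 1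

/-- `x` is an optimal solution of the LP relaxation of maximum independent set on `G[W]`. -/
def LPOptimal (G : SimpleGraph V) (W : Finset V) (x : V → ℝ) : Prop :=
  LPFeasible G W x ∧ ∀ y : V → ℝ, LPFeasible G W y → ∑ v ∈ W, y v ≤ ∑ v ∈ W, x v

/-- Every value of `x` on `W` is `0`, `1/2` or `1`. -/
def HalfIntegralOn (W : Finset V) (x : V → ℝ) : Prop :=
  ∀ v ∈ W, x v = 0 ∨ x v = 1 / 2 ∨ x v = 1

/-- The degree of `v` in the subgraph induced on `A` (for `v ∈ A`). -/
def degreeIn (G : SimpleGraph V) [DecidableRel G.Adj] (A : Finset V) (v : V) : ℕ :=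
  (A.filter (fun u => G.Adj v u)).card

/-- `GreedyRun G A T`: the greedy algorithm run on the induced subgraph `G[A]` can return `T`.
While vertices remain, it picks some vertex `v` of minimum degree in the current graph (ties
are broken arbitrarily), adds `v` to the output and deletes `v` and its neighbours. -/
inductive GreedyRun (G : SimpleGraph V) [DecidableRel G.Adj] : Finset V → Finset V → Prop
  | done : GreedyRun G ∅ ∅
  | pick (A T : Finset V) (v : V) (hv : v ∈ A)
      (hmin : ∀ u ∈ A, degreeIn G A v ≤ degreeIn G A u)
      (hrest : GreedyRun G (A.filter (fun u => u ≠ v ∧ ¬ G.Adj v u)) T) :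
      GreedyRun G A (insert v T)

/-- `PLGOutput G π S`: once the ordering `π` has been drawn, algorithm PLG can return `S`.
On `G_3` it takes some optimal half-integral LP solution `x`, keeps the vertices of value `1`,
discards those of value `0`, and runs greedy on the subgraph induced on the remaining vertices,
those of value `1/2`. -/
def PLGOutput (G : SimpleGraph V) [DecidableRel G.Adj] (π : VertexOrder V) (S : Finset V) :
    Prop :=
  ∃ (x : V → ℝ) (T : Finset V),
    LPOptimal G (firstLayers G π 3) x ∧ HalfIntegralOn (firstLayers G π 3) x ∧
    GreedyRun G ((firstLayers G π 3).filter (fun v => x v = 1 / 2)) T ∧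
    S = (firstLayers G π 3).filter (fun v => x v = 1) ∪ T

/-- `π` and `S` are the random ordering and the random output of an execution of algorithm PLG
on `G`: the ordering is uniformly distributed, and the output is one that PLG can return for
that ordering. The choice of the LP solution and the breaking of ties in greedy are arbitrary;
they may depend on the ordering and on further randomness. -/
structure IsExecution (G : SimpleGraph V) [DecidableRel G.Adj] {Ω : Type*} [MeasurableSpace Ω]
    (μ : Measure Ω) (π : Ω → VertexOrder V) (S : Ω → Finset V) : Prop where
  measurableSet_order : ∀ σ : VertexOrder V, MeasurableSet {ω | π ω = σ}
  measurableSet_output : ∀ T : Finset V, MeasurableSet {ω | S ω = T}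
  uniform : ∀ σ : VertexOrder V,
    μ {ω | π ω = σ} = ((Nat.factorial (Fintype.card V) : ℕ) : ENNReal)⁻¹
  output : ∀ᵐ ω ∂μ, PLGOutput G (π ω) (S ω)

end PLG

namespace PLG

open Finset

/-! ### Degree sums and the greedy algorithm. -/

section Combinatorics

variable {V : Type*} (G : SimpleGraph V) [DecidableRel G.Adj]

/-! The constant obtained is 9/4, and 9/4 ≥ 15/7. Everything rests on a deterministic inequality,
`PLGOutput.card_bound`: for every ordering and every independent set `I`, with `W = L₁ ∪ L₂ ∪ L₃`,
`3|W ∩ I| + |L₁| ≤ 4|S| + |L₃|`. Since all degrees are at least 2, each vertex `v` lies in each of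
`L₁`, `L₂`, `L₃` with probability `1/(d(v)+1)`. So `|L₁|` and `|L₃|` have the same expectation and
cancel, while `|W ∩ I|` has expectation `3 ∑ 1/(d(v)+1)` over `I`; dividing by 4 gives 9/4.

The deterministic inequality splits `W` into `H`, `P`, `Z`, the vertices of LP value 1/2, 1, 0.
Optimality of the LP gives `2|H ∩ I| ≤ |H|`, `|(P ∪ Z) ∩ I| ≤ |P|`, and a neighbour in `P` for each
vertex of `Z`. Greedy on `H` returns `T` with `4|H| + 2|H ∩ I| ≤ 8|T| + 2e(H)`
(`GreedyRun.card_bound`). Finally `e(W) ≤ |L₂| + 2|L₃|`, because a vertex of `Lᵢ` has `i - 1`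
earlier neighbours, and at least `|Z|` of these edges lie outside `H`. The rest is linear
arithmetic. -/

lemma degreeIn_eq_sum (A : Finset V) (v : V) :
    degreeIn G A v = ∑ u ∈ A, if G.Adj v u then 1 else 0 := by
  rw [degreeIn, card_filter]

lemma degreeIn_mono {A B : Finset V} (h : A ⊆ B) (v : V) : degreeIn G A v ≤ degreeIn G B v :=
  card_le_card (filter_subset_filter _ h)

/-- Double counting of the edges between two sets. -/
lemma sum_degreeIn_comm (A B : Finset V) :
    ∑ v ∈ A, degreeIn G B v = ∑ v ∈ B, degreeIn G A v := by
  simp only [degreeIn_eq_sum]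
  rw [sum_comm]
  simp only [G.adj_comm]

variable [DecidableEq V]

lemma degreeIn_union {A B : Finset V} (h : Disjoint A B) (v : V) :
    degreeIn G (A ∪ B) v = degreeIn G A v + degreeIn G B v := by
  simp only [degreeIn_eq_sum, sum_union h]

/-- The number of adjacent ordered pairs in `R` is at most the number of ordered pairs of
distinct elements that do not both lie in the independent set `I`. -/
lemma sum_degreeIn_le (R I : Finset V) (hI : G.IsIndepSet (I : Set V)) :
    ∑ v ∈ R, (degreeIn G R v : ℤ) ≤
      (#R : ℤ) * (#R - 1) - (#(R ∩ I) : ℤ) * (#(R ∩ I) - 1) := by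
  have hbound : ∀ v ∈ R, (degreeIn G R v : ℤ) ≤
      (#R - 1) - if v ∈ I then (#(R ∩ I) - 1 : ℤ) else 0 := by
    intro v hv
    split_ifs with hvI
    · have hsub : R.filter (fun u => G.Adj v u) ⊆ R \ (R ∩ I) := by
        intro u hu
        simp only [mem_filter, mem_sdiff, mem_inter, not_and] at hu ⊢
        refine ⟨hu.1, fun _ huI => ?_⟩
        exact hI (mem_coe.2 hvI) (mem_coe.2 huI) (G.ne_of_adj hu.2) hu.2
      have h1 := card_le_card hsub
      have h2 := card_sdiff_add_card_eq_card (inter_subset_left : R ∩ I ⊆ R)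
      unfold degreeIn
      omega
    · have hsub : R.filter (fun u => G.Adj v u) ⊆ R.erase v := by
        intro u hu
        simp only [mem_filter, mem_erase] at hu ⊢
        exact ⟨(G.ne_of_adj hu.2).symm, hu.1⟩
      have h1 := card_le_card hsub
      have h2 := card_erase_add_one hv
      unfold degreeIn
      omega
  refine (sum_le_sum hbound).trans (le_of_eq ?_)
  rw [sum_sub_distrib, sum_const, ← sum_filter, sum_const, filter_mem_eq_inter]
  simp

/-- Serves to measure the drop in the degree sum when greedy deletes `A` from `A ∪ B`. The term with
`A` alone stands on the left to avoid natural subtraction. -/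
lemma sum_degreeIn_union {A B : Finset V} (h : Disjoint A B) :
    ∑ v ∈ A ∪ B, degreeIn G (A ∪ B) v + ∑ v ∈ A, degreeIn G A v =
      ∑ v ∈ B, degreeIn G B v + 2 * ∑ v ∈ A, degreeIn G (A ∪ B) v := by
  rw [sum_union h]
  simp only [degreeIn_union G h, sum_add_distrib]
  rw [sum_degreeIn_comm G B A]
  ring

variable {G}

lemma GreedyRun.subset {A T : Finset V} (h : GreedyRun G A T) : T ⊆ A := by
  induction h with
  | done => simp
  | pick A T v hv hmin hrest ih =>
    exact insert_subset hv (ih.trans (filter_subset _ _))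

lemma GreedyRun.isIndepSet {A T : Finset V} (h : GreedyRun G A T) :
    G.IsIndepSet (T : Set V) := by
  induction h with
  | done => simp [SimpleGraph.IsIndepSet]
  | pick A T v hv hmin hrest ih =>
    rw [coe_insert]
    refine Set.Pairwise.insert ih fun u hu _ => ?_
    have hadj := (mem_filter.1 (hrest.subset (mem_coe.1 hu))).2.2
    exact ⟨hadj, fun h => hadj h.symm⟩

variable (G) in
lemma exists_greedyRun (A : Finset V) : ∃ T, GreedyRun G A T := by
  induction A using Finset.strongInduction with
  | H A ih =>
    rcases A.eq_empty_or_nonempty with rfl | hA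
    · exact ⟨∅, .done⟩
    · obtain ⟨v, hv, hmin⟩ := exists_min_image A (degreeIn G A) hA
      obtain ⟨T, hT⟩ := ih (A.filter (fun u => u ≠ v ∧ ¬ G.Adj v u))
        (filter_ssubset.2 ⟨v, hv, by simp⟩)
      exact ⟨_, .pick A T v hv hmin hT⟩

/-- A lower bound for the output of greedy in terms of the numbers of vertices and edges and the
size of an independent set. -/
lemma GreedyRun.card_bound {A T : Finset V} (h : GreedyRun G A T) (I : Finset V)
    (hI : G.IsIndepSet (I : Set V)) :
    4 * #A + 2 * #(A ∩ I) ≤ 8 * #T + ∑ v ∈ A, degreeIn G A v := by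
  induction h with
  | done => simp
  | pick A T v hv hmin hrest ih =>
    set B := A.filter (fun u => u ≠ v ∧ ¬ G.Adj v u) with hB
    set R := A.filter (fun u => ¬ (u ≠ v ∧ ¬ G.Adj v u)) with hR
    have hdisj : Disjoint R B := (disjoint_filter_filter_not A A _).symm
    have hA : R ∪ B = A := by rw [union_comm]; exact filter_union_filter_not_eq _ _
    have hvT : v ∉ T := fun hvT => by simpa [hB] using hrest.subset hvT
    have hRcard : #R = degreeIn G A v + 1 := by
      have : R = insert v (A.filter (fun u => G.Adj v u)) := by
        ext u
        simp only [hR, mem_filter, mem_insert]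
        by_cases huv : u = v
        · simp [huv, hv]
        · simp [huv]
      rw [this, card_insert_of_notMem (by simp), degreeIn]
    have hdeg : #R * degreeIn G A v ≤ ∑ u ∈ R, degreeIn G A u := by
      rw [← smul_eq_mul]
      exact card_nsmul_le_sum _ _ _ fun u hu => hmin u (filter_subset _ _ hu)
    have hsum := sum_degreeIn_union G hdisj
    have hin := sum_degreeIn_le G R I hI
    have hcA : #A = #R + #B := by rw [← hA, card_union_of_disjoint hdisj]
    have hcI : #(A ∩ I) = #(R ∩ I) + #(B ∩ I) := by
      rw [← hA, union_inter_distrib_right, card_union_of_disjoint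
        (hdisj.mono inter_subset_left inter_subset_left)]
    rw [hA] at hsum
    rw [card_insert_of_notMem hvT, hcA, hcI]
    -- With `r = #R` and `k = #(R ∩ I)`, the degree sum drops by at least `2r(r-1) - (r(r-1) -
    -- k(k-1)) = r(r-1) + k(k-1)`. The induction step needs this to be at least `4r + 2k - 8`, and
    -- the difference is `(r-2)(r-3) + (k-1)(k-2)`, nonnegative for integers.
    have hint : ∀ a : ℤ, 0 ≤ (a - 1) * (a - 2) := fun a => by
      rcases le_or_gt a 1 with h | h
      · exact mul_nonneg_of_nonpos_of_nonpos (by omega) (by omega)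
      · exact mul_nonneg (by omega) (by omega)
    have h1 := hint (#R - 1)
    have h2 := hint #(R ∩ I)
    zify at hdeg hsum ih hRcard ⊢
    rw [eq_sub_of_add_eq hRcard.symm] at hdeg
    nlinarith

end Combinatorics

/-! ### Half-integrality and exchange arguments for the LP. -/

section LinearProgram

variable {V : Type*} {G : SimpleGraph V} {W : Finset V} {x : V → ℝ}

lemma sum_piecewise_sub (W : Finset V) (x y : V → ℝ) (C : Finset V) (hC : C ⊆ W)
    (hxy : ∀ v ∈ W, v ∉ C → y v = x v) :
    ∑ v ∈ W, y v - ∑ v ∈ W, x v = ∑ v ∈ C, (y v - x v) := by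
  rw [← sum_sub_distrib]
  refine (sum_subset hC fun v hv hvC => ?_).symm
  rw [hxy v hv hvC, sub_self]

lemma integral_threshold {a : ℝ} (h0 : 0 ≤ a) (h1 : a ≤ 1) :
    ∫ θ in Set.Ioc (0 : ℝ) 1,
      ((Set.Iic a).indicator (fun _ => (1 / 2 : ℝ)) θ +
        (Set.Ioi (1 - a)).indicator (fun _ => (1 / 2 : ℝ)) θ) = a := by
  have hint : ∀ s : Set ℝ, MeasurableSet s →
      Integrable (s.indicator (fun _ => (1 / 2 : ℝ))) (volume.restrict (Set.Ioc (0 : ℝ) 1)) :=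
    fun s hs => (integrable_const _).indicator hs
  rw [integral_add (hint _ measurableSet_Iic) (hint _ measurableSet_Ioi),
    integral_indicator_const _ measurableSet_Iic, integral_indicator_const _ measurableSet_Ioi,
    measureReal_restrict_apply measurableSet_Iic, measureReal_restrict_apply measurableSet_Ioi]
  have e1 : Set.Iic a ∩ Set.Ioc (0 : ℝ) 1 = Set.Ioc 0 a := by
    ext t; simp only [Set.mem_inter_iff, Set.mem_Iic, Set.mem_Ioc]; grind
  have e2 : Set.Ioi (1 - a) ∩ Set.Ioc (0 : ℝ) 1 = Set.Ioc (1 - a) 1 := by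
    ext t; simp only [Set.mem_inter_iff, Set.mem_Ioi, Set.mem_Ioc]; grind
  rw [e1, e2, Real.volume_real_Ioc_of_le h0, Real.volume_real_Ioc_of_le (by linarith)]
  simp only [smul_eq_mul]
  ring

/-- The value of a feasible solution is at most that of some half-integral feasible solution, by
rounding at a random threshold. -/
lemma LPFeasible.sum_le_of_halfIntegral (hx : LPFeasible G W x) {M : ℝ}
    (hM : ∀ y : V → ℝ, LPFeasible G W y → HalfIntegralOn W y → ∑ v ∈ W, y v ≤ M) :
    ∑ v ∈ W, x v ≤ M := by
  set y : ℝ → V → ℝ := fun θ v =>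
    (Set.Iic (x v)).indicator (fun _ => (1 / 2 : ℝ)) θ +
      (Set.Ioi (1 - x v)).indicator (fun _ => (1 / 2 : ℝ)) θ with hy
  have hint : ∀ v ∈ W, IntegrableOn (fun θ => y θ v) (Set.Ioc (0 : ℝ) 1) := fun v _ =>
    ((integrable_const _).indicator measurableSet_Iic).add
      ((integrable_const _).indicator measurableSet_Ioi)
  have hhalf : ∀ θ, HalfIntegralOn W (y θ) := by
    intro θ v _
    simp only [hy, Set.indicator_apply]
    split_ifs <;> norm_num
  have hfeas : ∀ θ, LPFeasible G W (y θ) := by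
    intro θ
    refine ⟨fun v hv => ?_, fun u hu v hv huv => ?_⟩
    · rcases hhalf θ v hv with h | h | h <;> rw [h] <;> norm_num
    -- If `θ ≤ x u` then `θ ≤ 1 - x v`, so the first indicator at `u` and the second at `v` are
    -- never both on, and symmetrically; hence the two values add up to at most 1.
    · have := hx.2 u hu v hv huv
      simp only [hy, Set.indicator_apply, Set.mem_Iic, Set.mem_Ioi]
      split_ifs <;> first | (norm_num; done) | (exfalso; linarith)
  calc ∑ v ∈ W, x v = ∑ v ∈ W, ∫ θ in Set.Ioc (0 : ℝ) 1, y θ v :=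
        sum_congr rfl fun v hv => (integral_threshold (hx.1 v hv).1 (hx.1 v hv).2).symm
    _ = ∫ θ in Set.Ioc (0 : ℝ) 1, ∑ v ∈ W, y θ v := (integral_finsetSum _ hint).symm
    _ ≤ ∫ _ in Set.Ioc (0 : ℝ) 1, M :=
        integral_mono (integrable_finsetSum _ hint) (integrable_const _)
          fun θ => hM _ (hfeas θ) (hhalf θ)
    _ = M := by simp

/-- On half-integral points the objective takes finitely many values, so it has a maximum there;
threshold rounding shows that no feasible point exceeds it. -/
lemma exists_lpOptimal_halfIntegral (G : SimpleGraph V) (W : Finset V) :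
    ∃ x : V → ℝ, LPOptimal G W x ∧ HalfIntegralOn W x := by
  set K : Set (V → ℝ) := {y | LPFeasible G W y ∧ HalfIntegralOn W y} with hK
  set f : (V → ℝ) → ℝ := fun y => ∑ v ∈ W, y v with hf
  have hfin : (f '' K).Finite := by
    refine ((Set.finite_Iic (2 * #W)).image (fun n : ℕ => (n : ℝ) / 2)).subset ?_
    rintro _ ⟨y, hy, rfl⟩
    have hex : ∀ v ∈ W, ∃ n : ℕ, n ≤ 2 ∧ y v = n / 2 := fun v hv => by
      rcases hy.2 v hv with h | h | h
      · exact ⟨0, by norm_num, by simp [h]⟩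
      · exact ⟨1, by norm_num, by simp [h]⟩
      · exact ⟨2, by norm_num, by simp [h]⟩
    choose! n hn hyn using hex
    refine ⟨∑ v ∈ W, n v, ?_, ?_⟩
    · rw [Set.mem_Iic, mul_comm, ← smul_eq_mul]
      exact sum_le_card_nsmul _ _ _ hn
    · simp only [hf]
      rw [sum_congr rfl hyn, ← sum_div]
      push_cast
      rfl
  have hne : K.Nonempty := ⟨0, ⟨fun v _ => by simp, fun u _ v _ _ => by simp⟩,
    fun v _ => Or.inl rfl⟩
  obtain ⟨_, ⟨x, hx, rfl⟩, hmax⟩ := Set.exists_max_image (f '' K) id hfin (hne.image f)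
  refine ⟨x, ⟨hx.1, fun y hy => hy.sum_le_of_halfIntegral fun w hw hw' => ?_⟩, hx.2⟩
  exact hmax _ ⟨w, ⟨hw, hw'⟩, rfl⟩

variable [DecidableEq V]

/-- In an optimal half-integral solution, no independent set contains more than half of the
vertices of value `1/2`. -/
lemma LPOptimal.two_mul_card_half_inter_le (hx : LPOptimal G W x) (hhalf : HalfIntegralOn W x)
    {I : Finset V} (hI : G.IsIndepSet (I : Set V)) :
    2 * #((W.filter (fun v => x v = 1 / 2)) ∩ I) ≤ #(W.filter (fun v => x v = 1 / 2)) := by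
  set H := W.filter (fun v => x v = 1 / 2) with hH
  -- Replacing 1/2 on `H` by the indicator of `I` stays feasible: neighbours of `H` in `W` have
  -- value 0 or lie in `H` themselves.
  set y : V → ℝ := fun v => if v ∈ H then (if v ∈ I then 1 else 0) else x v with hy
  have hfeas : LPFeasible G W y := by
    refine ⟨fun v hv => ?_, fun u hu v hv huv => ?_⟩
    · simp only [hy]
      split_ifs
      · norm_num
      · norm_num
      · exact hx.1.1 v hv
    · have hle := hx.1.2 u hu v hv huv
      have hind : ¬ (u ∈ I ∧ v ∈ I) := fun h => hI (mem_coe.2 h.1) (mem_coe.2 h.2) huv.ne huv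
      have hu' := hhalf u hu
      have hv' := hhalf v hv
      by_cases huH : x u = 1 / 2 <;> by_cases hvH : x v = 1 / 2 <;>
        by_cases huI : u ∈ I <;> by_cases hvI : v ∈ I <;>
        simp only [hy, hH, mem_filter, hu, hv, huH, hvH, huI, hvI, true_and, if_true, if_false,
          and_self, not_true_eq_false] at * <;> grind
  have hle := hx.2 y hfeas
  have hdiff := sum_piecewise_sub W x y H (filter_subset _ _) (fun v _ hv => by simp [hy, hv])
  have hval : ∑ v ∈ H, (y v - x v) = #(H ∩ I) - #H / 2 := by
    rw [sum_congr rfl (g := fun v => (if v ∈ I then (1 : ℝ) else 0) - 1 / 2) (fun v hv => by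
      simp only [hy, if_pos hv, (mem_filter.1 hv).2])]
    rw [sum_sub_distrib, ← sum_filter, filter_mem_eq_inter]
    simp
    ring
  have : (2 * #(H ∩ I) : ℝ) ≤ #H := by linarith
  exact_mod_cast this

/-- In an optimal half-integral solution, an independent set contains at most as many vertices of
value `0` or `1` as there are vertices of value `1`. -/
lemma LPOptimal.card_integral_inter_le (hx : LPOptimal G W x) (hhalf : HalfIntegralOn W x)
    {I : Finset V} (hI : G.IsIndepSet (I : Set V)) :
    #((W.filter (fun v => x v = 0)) ∩ I) + #((W.filter (fun v => x v = 1)) ∩ I) ≤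
      #(W.filter (fun v => x v = 1)) := by
  set Z := W.filter (fun v => x v = 0) with hZ
  set P := W.filter (fun v => x v = 1) with hP
  have hdisj : Disjoint (Z ∩ I) (P \ I) := by
    rw [Finset.disjoint_left]
    simp only [mem_inter, mem_sdiff]
    tauto
  -- Moving `Z ∩ I` up and `P \ I` down to 1/2 stays feasible, since a neighbour in `P` of a vertex
  -- of `Z ∩ I` is outside `I` and is lowered too. Optimality then yields `#(Z ∩ I) ≤ #(P \ I)`.
  set C := (Z ∩ I) ∪ (P \ I) with hC
  have hCW : C ⊆ W := union_subset (inter_subset_left.trans (filter_subset _ _))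
    (sdiff_subset.trans (filter_subset _ _))
  set y : V → ℝ := fun v => if v ∈ C then 1 / 2 else x v with hy
  have hfeas : LPFeasible G W y := by
    refine ⟨fun v hv => ?_, fun u hu v hv huv => ?_⟩
    · simp only [hy]
      split_ifs
      · norm_num
      · exact hx.1.1 v hv
    · have hle := hx.1.2 u hu v hv huv
      have hind : ¬ (u ∈ I ∧ v ∈ I) := fun h => hI (mem_coe.2 h.1) (mem_coe.2 h.2) huv.ne huv
      have hu' := hhalf u hu
      have hv' := hhalf v hv
      simp only [hy, hC, hZ, hP, mem_union, mem_inter, mem_sdiff, mem_filter, hu, hv, true_and]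
      clear_value y C P Z
      clear hI hx hhalf hC hy hZ hP hCW hdisj
      rcases hu' with hu' | hu' | hu' <;> rcases hv' with hv' | hv' | hv' <;>
        simp only [hu', hv'] at hle ⊢ <;> split_ifs <;> first | (norm_num; done) | grind
  have hle := hx.2 y hfeas
  have hdiff := sum_piecewise_sub W x y C hCW (fun v _ hv => by simp [hy, hv])
  rw [sum_union hdisj,
    sum_congr rfl (s₁ := Z ∩ I) (g := fun _ => (1 / 2 : ℝ)) (fun v hv => by
      have hvC : v ∈ C := mem_union_left _ hv
      simp [hy, if_pos hvC, (mem_filter.1 (mem_inter.1 hv).1).2]),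
    sum_congr rfl (s₁ := P \ I) (g := fun _ => (-(1 / 2) : ℝ)) (fun v hv => by
      have hvC : v ∈ C := mem_union_right _ hv
      simp only [hy, if_pos hvC, (mem_filter.1 (mem_sdiff.1 hv).1).2]
      norm_num)] at hdiff
  simp only [sum_const, nsmul_eq_mul] at hdiff
  have hcard : #(Z ∩ I) ≤ #(P \ I) := by
    have : (#(Z ∩ I) : ℝ) ≤ #(P \ I) := by linarith
    exact_mod_cast this
  have := card_sdiff_add_card_inter P I
  omega

/-- In an optimal half-integral solution, each vertex of value `0` has a neighbour of
value `1`. -/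
lemma LPOptimal.exists_adj_of_eq_zero (hx : LPOptimal G W x) (hhalf : HalfIntegralOn W x)
    {z : V} (hz : z ∈ W) (hxz : x z = 0) : ∃ p ∈ W, x p = 1 ∧ G.Adj z p := by
  by_contra! hno
  -- Without a neighbour of value 1, `z` could be raised to 1/2, improving the objective.
  set y : V → ℝ := fun v => if v = z then 1 / 2 else x v with hy
  have hfeas : LPFeasible G W y := by
    refine ⟨fun v hv => ?_, fun u hu v hv huv => ?_⟩
    · simp only [hy]
      split_ifs
      · norm_num
      · exact hx.1.1 v hv
    · have hle := hx.1.2 u hu v hv huv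
      have hu' := hhalf u hu
      have hv' := hhalf v hv
      have hnu := hno u hu
      have hnv := hno v hv
      have hvu := huv.symm
      simp only [hy]
      split_ifs with h1 h2 h2
      · norm_num
      · subst h1
        rcases hv' with hv' | hv' | hv'
        · linarith
        · linarith
        · exact absurd huv (hnv hv')
      · subst h2
        rcases hu' with hu' | hu' | hu'
        · linarith
        · linarith
        · exact absurd hvu (hnu hu')
      · exact hle
  have hle := hx.2 y hfeas
  have hdiff := sum_piecewise_sub W x y {z} (by simpa using hz) (fun v _ hv => by
    simp only [mem_singleton] at hv
    simp [hy, hv])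
  simp [hy, hxz] at hdiff
  linarith

end LinearProgram

/-! ### Edge counts in the layers and the bound for a fixed ordering. -/

section Layers

variable {V : Type*} [Fintype V] (G : SimpleGraph V) [DecidableRel G.Adj] (π : VertexOrder V)

lemma mem_layer {i : ℕ} {v : V} :
    v ∈ layer G π i ↔ #((G.neighborFinset v).filter (fun u => π u < π v)) + 1 = i := by
  simp [layer]

lemma disjoint_layer {i j : ℕ} (h : i ≠ j) : Disjoint (layer G π i) (layer G π j) := by
  rw [Finset.disjoint_left]
  intro v hv hv'
  rw [mem_layer] at hv hv'
  exact h (hv.symm.trans hv')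

variable [DecidableEq V]

lemma sum_firstLayers {M : Type*} [AddCommMonoid M] (k : ℕ) (f : V → M) :
    ∑ v ∈ firstLayers G π k, f v = ∑ i ∈ Icc 1 k, ∑ v ∈ layer G π i, f v :=
  sum_biUnion fun _ _ _ _ hij => disjoint_layer G π hij

lemma card_firstLayers_inter (k : ℕ) (I : Finset V) :
    #(firstLayers G π k ∩ I) = ∑ i ∈ Icc 1 k, #(layer G π i ∩ I) := by
  rw [firstLayers, biUnion_inter]
  exact card_biUnion fun i _ j _ hij =>
    (disjoint_layer G π hij).mono inter_subset_left inter_subset_left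

/-- Each vertex of the `i`-th layer is joined to at most `i - 1` earlier vertices. -/
lemma sum_degreeIn_firstLayers_le (k : ℕ) :
    ∑ v ∈ firstLayers G π k, degreeIn G (firstLayers G π k) v ≤
      2 * ∑ i ∈ Icc 1 k, (i - 1) * #(layer G π i) := by
  set W := firstLayers G π k
  set b : V → ℕ := fun v => #(W.filter (fun u => G.Adj v u ∧ π u < π v)) with hb
  -- Each edge is charged to its later endpoint, so `b` counts every edge once.
  have hsplit : ∑ v ∈ W, degreeIn G W v = 2 * ∑ v ∈ W, b v := by
    have h1 : ∀ v ∈ W, degreeIn G W v = b v + #(W.filter (fun u => G.Adj v u ∧ π v < π u)) := by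
      intro v _
      rw [degreeIn, hb, ← card_union_of_disjoint]
      · congr 1
        ext u
        simp only [mem_filter, mem_union]
        constructor
        · rintro ⟨hu, huv⟩
          rcases lt_trichotomy (π u) (π v) with h | h | h
          · exact Or.inl ⟨hu, huv, h⟩
          · exact absurd (π.injective h).symm huv.ne
          · exact Or.inr ⟨hu, huv, h⟩
        · tauto
      · rw [Finset.disjoint_left]
        intro u hu hu'
        exact lt_asymm (mem_filter.1 hu).2.2 (mem_filter.1 hu').2.2
    have h2 : ∑ v ∈ W, #(W.filter (fun u => G.Adj v u ∧ π v < π u)) = ∑ v ∈ W, b v := by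
      simp only [hb, card_filter]
      rw [sum_comm]
      simp only [G.adj_comm]
    rw [sum_congr rfl h1, sum_add_distrib, h2]
    ring
  rw [hsplit, sum_firstLayers]
  refine Nat.mul_le_mul_left 2 (sum_le_sum fun i _ => ?_)
  rw [mul_comm, ← smul_eq_mul]
  refine sum_le_card_nsmul _ _ _ fun v hv => ?_
  rw [mem_layer] at hv
  have : b v ≤ #((G.neighborFinset v).filter (fun u => π u < π v)) := by
    refine card_le_card fun u hu => ?_
    simp only [mem_filter, SimpleGraph.mem_neighborFinset] at hu ⊢
    exact hu.2
  omega

variable {G π}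

lemma PLGOutput.isIndepSet {S : Finset V} (h : PLGOutput G π S) :
    G.IsIndepSet (S : Set V) := by
  obtain ⟨x, T, hx, -, hT, rfl⟩ := h
  have hmem : ∀ v ∈ T, v ∈ firstLayers G π 3 ∧ x v = 1 / 2 := fun v hv =>
    mem_filter.1 (hT.subset hv)
  intro u hu v hv huv hadj
  simp only [coe_union, Set.mem_union, mem_coe, mem_filter] at hu hv
  rcases hu with hu | hu <;> rcases hv with hv | hv
  · have := hx.1.2 u hu.1 v hv.1 hadj
    linarith [hu.2, hv.2]
  · have := hx.1.2 u hu.1 v (hmem v hv).1 hadj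
    linarith [hu.2, (hmem v hv).2]
  · have := hx.1.2 u (hmem u hu).1 v hv.1 hadj
    linarith [hv.2, (hmem u hu).2]
  · exact hT.isIndepSet (mem_coe.2 hu) (mem_coe.2 hv) huv hadj

variable (G π) in
lemma exists_plgOutput : ∃ S, PLGOutput G π S := by
  obtain ⟨x, hx, hhalf⟩ := exists_lpOptimal_halfIntegral G (firstLayers G π 3)
  obtain ⟨T, hT⟩ := exists_greedyRun G ((firstLayers G π 3).filter (fun v => x v = 1 / 2))
  exact ⟨_, x, T, hx, hhalf, hT, rfl⟩

/-- The bound on the output that holds for every ordering. -/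
lemma PLGOutput.card_bound {S : Finset V} (h : PLGOutput G π S) {I : Finset V}
    (hI : G.IsIndepSet (I : Set V)) :
    3 * #(firstLayers G π 3 ∩ I) + #(layer G π 1) ≤ 4 * #S + #(layer G π 3) := by
  obtain ⟨x, T, hx, hhalf, hT, rfl⟩ := h
  have hlayers := sum_degreeIn_firstLayers_le G π 3
  have hcard := card_firstLayers_inter G π 3 univ
  simp only [inter_univ] at hcard
  have hIcc : Icc 1 3 = ({1, 2, 3} : Finset ℕ) := rfl
  rw [hIcc, sum_insert (by simp), sum_insert (by simp), sum_singleton] at hlayers hcard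
  have hIH := hx.two_mul_card_half_inter_le hhalf hI
  have hIPZ := hx.card_integral_inter_le hhalf hI
  have hadj := fun z hz => hx.exists_adj_of_eq_zero hhalf (z := z) hz
  have hgreedy := hT.card_bound I hI
  have hTH := hT.subset
  set W := firstLayers G π 3
  set Z := W.filter (fun v => x v = 0) with hZ
  set P := W.filter (fun v => x v = 1) with hP
  set H := W.filter (fun v => x v = 1 / 2) with hH
  have hHP : Disjoint H P := disjoint_filter.2 fun v _ h h' => by norm_num [h] at h'
  have hHZ : Disjoint H Z := disjoint_filter.2 fun v _ h h' => by norm_num [h] at h'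
  have hPZ : Disjoint P Z := disjoint_filter.2 fun v _ h h' => by norm_num [h] at h'
  have hHPZ : Disjoint H (P ∪ Z) := disjoint_union_right.2 ⟨hHP, hHZ⟩
  have hW : W = H ∪ (P ∪ Z) := by
    ext v
    have := hhalf v
    simp only [hH, hP, hZ, mem_union, mem_filter]
    tauto
  have hS : #(P ∪ T) = #P + #T :=
    card_union_of_disjoint (hHP.symm.mono_right hTH)
  have hcW : #W = #H + (#P + #Z) := by
    conv_lhs => rw [hW]
    rw [card_union_of_disjoint hHPZ, card_union_of_disjoint hPZ]
  have hcI : #(W ∩ I) = #(H ∩ I) + (#(P ∩ I) + #(Z ∩ I)) := by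
    conv_lhs => rw [hW]
    rw [union_inter_distrib_right, union_inter_distrib_right, card_union_of_disjoint,
      card_union_of_disjoint (hPZ.mono inter_subset_left inter_subset_left)]
    rw [← union_inter_distrib_right]
    exact hHPZ.mono inter_subset_left inter_subset_left
  have hZdeg : #Z ≤ ∑ v ∈ Z, degreeIn G P v := by
    rw [card_eq_sum_ones]
    refine sum_le_sum fun z hz => ?_
    obtain ⟨p, hpW, hxp, hzp⟩ := hadj z (mem_filter.1 hz).1 (mem_filter.1 hz).2
    exact card_pos.2 ⟨p, mem_filter.2 ⟨mem_filter.2 ⟨hpW, hxp⟩, hzp⟩⟩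
  -- The edges between `P` and `Z` number at least `#Z`, and each enters the degree sum at both
  -- ends, whence the factor 2.
  have hdegree : ∑ v ∈ H, degreeIn G H v + 2 * #Z ≤ ∑ v ∈ W, degreeIn G W v := by
    have hsplit : ∑ v ∈ W, degreeIn G W v = ∑ v ∈ H, degreeIn G W v +
        (∑ v ∈ P, degreeIn G W v + ∑ v ∈ Z, degreeIn G W v) := by
      rw [← sum_union hPZ, ← sum_union hHPZ, ← hW]
    have h1 : ∑ v ∈ H, degreeIn G H v ≤ ∑ v ∈ H, degreeIn G W v :=
      sum_le_sum fun v _ => degreeIn_mono G (filter_subset _ _) v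
    have h2 : ∑ v ∈ P, degreeIn G Z v ≤ ∑ v ∈ P, degreeIn G W v :=
      sum_le_sum fun v _ => degreeIn_mono G (filter_subset _ _) v
    have h3 : ∑ v ∈ Z, degreeIn G P v ≤ ∑ v ∈ Z, degreeIn G W v :=
      sum_le_sum fun v _ => degreeIn_mono G (filter_subset _ _) v
    rw [sum_degreeIn_comm] at h2
    omega
  -- Greedy and the edge count give `4#T ≥ 2#H + #(H ∩ I) + #Z - #L₂ - 2#L₃`. Adding `4#P + #L₃` and
  -- using `#W = #L₁ + #L₂ + #L₃` leaves `3#P + #H + #(H ∩ I) + #L₁`, and the two LP bounds finish.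
  omega

end Layers

/-! ### Uniform ranks and expectations. -/

section Probability

lemma eq_sum_indicator {Ω α : Type*} [Fintype α] (X : Ω → α) (f : α → ℝ) :
    (fun ω => f (X ω)) = fun ω => ∑ a, {ω | X ω = a}.indicator (fun _ => f a) ω := by
  classical
  funext ω
  simp [Set.indicator_apply]

variable {V : Type*} [Fintype V]

/-- In an ordering, every position below `#A` is the rank in `A` of exactly one element. -/
lemma card_filter_rank_eq (π : VertexOrder V) (A : Finset V) {i : ℕ} (hi : i < #A) :
    #(A.filter (fun u => #(A.filter (fun w => π w < π u)) = i)) = 1 := by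
  set r : V → ℕ := fun u => #(A.filter (fun w => π w < π u)) with hr
  have hlt : ∀ u ∈ A, ∀ v ∈ A, π u < π v → r u < r v := by
    intro u hu v _ huv
    refine card_lt_card ⟨fun w hw => ?_, fun hsub => ?_⟩
    · rw [mem_filter] at hw ⊢
      exact ⟨hw.1, hw.2.trans huv⟩
    · have := hsub (mem_filter.2 ⟨hu, huv⟩)
      simp at this
  have hinj : Set.InjOn r A := by
    intro u hu v hv huv
    rcases lt_trichotomy (π u) (π v) with h | h | h
    · exact absurd huv (hlt u hu v hv h).ne
    · exact π.injective h
    · exact absurd huv (hlt v hv u hu h).ne'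
  have hmaps : ∀ u ∈ A, r u ∈ range #A := by
    intro u hu
    rw [mem_range]
    exact card_lt_card (filter_ssubset.2 ⟨u, hu, by simp⟩)
  obtain ⟨u, hu, hui⟩ := surj_on_of_inj_on_of_card_le (fun u _ => r u) hmaps
    (fun u v hu hv h => hinj hu hv h) (by simp) i (mem_range.2 hi)
  rw [card_eq_one]
  refine ⟨u, ?_⟩
  ext w
  simp only [mem_filter, mem_singleton]
  constructor
  · rintro ⟨hw, hwi⟩
    exact hinj hw hu (hwi.trans hui)
  · rintro rfl
    exact ⟨hu, hui.symm⟩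

variable [DecidableEq V] (G : SimpleGraph V) [DecidableRel G.Adj]

/-- The rank of an element of `A` in a uniformly random ordering of `A` is uniform. -/
lemma card_mul_card_orders_rank_eq (A : Finset V) {v : V} (hv : v ∈ A) {i : ℕ} (hi : i < #A) :
    #A * #{π : VertexOrder V | #(A.filter (fun w => π w < π v)) = i} =
      (Fintype.card V).factorial := by
  -- Precomposing with the swap of `u` and `v` is an involution on orderings that preserves `A` and
  -- exchanges their ranks. So all elements of `A` have rank `i` equally often, and in each ordering
  -- exactly one does.
  have hsymm : ∀ u ∈ A, #{π : VertexOrder V | #(A.filter (fun w => π w < π v)) = i} =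
      #{π : VertexOrder V | #(A.filter (fun w => π w < π u)) = i} := by
    intro u hu
    have key : ∀ π : VertexOrder V,
        #(A.filter (fun w => ((Equiv.swap u v).trans π) w < ((Equiv.swap u v).trans π) v)) =
          #(A.filter (fun w => π w < π u)) := by
      intro π
      have hA : ∀ w, w ∈ A → Equiv.swap u v w ∈ A := by
        intro w hw
        rw [Equiv.swap_apply_def]
        split_ifs <;> assumption
      refine card_bij' (fun w _ => Equiv.swap u v w) (fun w _ => Equiv.swap u v w) ?_ ?_ ?_ ?_
      · intro w hw
        simp only [mem_filter, Equiv.trans_apply, Equiv.swap_apply_right] at hw ⊢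
        exact ⟨hA w hw.1, hw.2⟩
      · intro w hw
        simp only [mem_filter, Equiv.trans_apply, Equiv.swap_apply_right,
          Equiv.swap_apply_self] at hw ⊢
        exact ⟨hA w hw.1, hw.2⟩
      · intro w _; simp
      · intro w _; simp
    refine card_bij' (fun π _ => (Equiv.swap u v).trans π) (fun π _ => (Equiv.swap u v).trans π)
      ?_ ?_ ?_ ?_
    · intro π hπ
      simp only [mem_filter, mem_univ, true_and] at hπ ⊢
      rw [← key, ← hπ]
      simp [← Equiv.trans_assoc]
    · intro π hπ
      simp only [mem_filter, mem_univ, true_and] at hπ ⊢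
      rw [key, hπ]
    · intro π _; ext w; simp
    · intro π _; ext w; simp
  calc #A * #{π : VertexOrder V | #(A.filter (fun w => π w < π v)) = i}
      = ∑ u ∈ A, #{π : VertexOrder V | #(A.filter (fun w => π w < π u)) = i} := by
        rw [← sum_congr rfl hsymm, sum_const, smul_eq_mul]
    _ = ∑ π : VertexOrder V, #(A.filter (fun u => #(A.filter (fun w => π w < π u)) = i)) := by
        simp only [card_filter _ univ, card_filter _ A]
        rw [sum_comm]
    _ = Fintype.card (VertexOrder V) := by
        rw [sum_congr rfl fun π _ => card_filter_rank_eq π A hi]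
        simp
    _ = (Fintype.card V).factorial := Fintype.card_equiv (Fintype.equivFin V)

/-- The layer index of `v` is one more than its rank, counted from 0, in its closed neighbourhood, a
set of size `d(v) + 1`. -/
lemma mul_card_orders_mem_layer (v : V) {i : ℕ} (hi : i ≤ G.degree v) :
    (G.degree v + 1) * #{π : VertexOrder V | v ∈ layer G π (i + 1)} =
      (Fintype.card V).factorial := by
  have hcard : #(insert v (G.neighborFinset v)) = G.degree v + 1 := by
    rw [card_insert_of_notMem (by simp), SimpleGraph.card_neighborFinset_eq_degree]
  rw [← card_mul_card_orders_rank_eq (insert v (G.neighborFinset v)) (mem_insert_self _ _)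
    (i := i) (by omega), hcard]
  congr 2
  ext π
  simp [mem_layer, filter_insert]

lemma sum_card_layer_inter (hG : ∀ v, 2 ≤ G.degree v) (I : Finset V) {i : ℕ} (hi : i ≤ 2) :
    ∑ π : VertexOrder V, (#(layer G π (i + 1) ∩ I) : ℝ) =
      (Fintype.card V).factorial * ∑ v ∈ I, 1 / ((G.degree v : ℝ) + 1) := by
  have hswap : ∑ π : VertexOrder V, #(layer G π (i + 1) ∩ I) =
      ∑ v ∈ I, #{π : VertexOrder V | v ∈ layer G π (i + 1)} := by
    simp only [inter_comm _ I, ← filter_mem_eq_inter, card_filter]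
    rw [sum_comm]
  rw [← Nat.cast_sum, hswap, Nat.cast_sum, mul_sum]
  refine sum_congr rfl fun v _ => ?_
  have h := mul_card_orders_mem_layer G v (hi.trans (hG v))
  have hpos : (0 : ℝ) < (G.degree v : ℝ) + 1 := by positivity
  rw [mul_one_div, eq_div_iff hpos.ne', ← h]
  push_cast
  ring

variable {G} {Ω : Type*} [MeasurableSpace Ω] {μ : Measure Ω}

lemma integrable_comp_of_fintype [IsFiniteMeasure μ] {α : Type*} [Fintype α] {X : Ω → α}
    (hX : ∀ a, MeasurableSet {ω | X ω = a}) (f : α → ℝ) : Integrable (fun ω => f (X ω)) μ := by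
  rw [eq_sum_indicator]
  exact integrable_finsetSum _ fun a _ => (integrable_const _).indicator (hX a)

lemma integral_comp_of_fintype [IsFiniteMeasure μ] {α : Type*} [Fintype α] {X : Ω → α}
    (hX : ∀ a, MeasurableSet {ω | X ω = a}) (f : α → ℝ) :
    ∫ ω, f (X ω) ∂μ = ∑ a, μ.real {ω | X ω = a} * f a := by
  rw [eq_sum_indicator, integral_finsetSum _ fun a _ => (integrable_const _).indicator (hX a)]
  refine sum_congr rfl fun a _ => ?_
  rw [integral_indicator_const _ (hX a), smul_eq_mul]

lemma IsExecution.integral_card_ge [IsProbabilityMeasure μ] {π : Ω → VertexOrder V}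
    {S : Ω → Finset V} (h : IsExecution G μ π S) (hG : ∀ v, 2 ≤ G.degree v) {I : Finset V}
    (hI : G.IsIndepSet (I : Set V)) :
    (9 / 4 : ℝ) * ∑ v ∈ I, 1 / ((G.degree v : ℝ) + 1) ≤ ∫ ω, ((S ω).card : ℝ) ∂μ := by
  -- Intersecting with `univ` lets `sum_card_layer_inter` also evaluate the full layers, whose
  -- contributions cancel.
  set g : VertexOrder V → ℝ := fun σ =>
    (3 * (#(layer G σ 1 ∩ I) + #(layer G σ 2 ∩ I) + #(layer G σ 3 ∩ I)) +
      #(layer G σ 1 ∩ univ) - #(layer G σ 3 ∩ univ)) / 4 with hg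
  have hle : ∀ᵐ ω ∂μ, g (π ω) ≤ ((S ω).card : ℝ) := by
    filter_upwards [h.output] with ω hω
    have hb := hω.card_bound hI
    have hIcc : Icc 1 3 = ({1, 2, 3} : Finset ℕ) := rfl
    rw [card_firstLayers_inter, hIcc, sum_insert (by simp), sum_insert (by simp),
      sum_singleton] at hb
    have hb' : (3 * (#(layer G (π ω) 1 ∩ I) + (#(layer G (π ω) 2 ∩ I) +
        #(layer G (π ω) 3 ∩ I))) + #(layer G (π ω) 1) : ℝ) ≤
        4 * #(S ω) + #(layer G (π ω) 3) := by exact_mod_cast hb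
    simp only [hg, inter_univ]
    linarith
  refine le_trans (le_of_eq ?_) (integral_mono_ae
    (integrable_comp_of_fintype h.measurableSet_order g)
    (integrable_comp_of_fintype h.measurableSet_output fun T => (#T : ℝ)) hle)
  rw [integral_comp_of_fintype h.measurableSet_order]
  have hfac : ((Fintype.card V).factorial : ℝ) ≠ 0 := by positivity
  have hreal : ∀ σ, μ.real {ω | π ω = σ} = ((Fintype.card V).factorial : ℝ)⁻¹ := fun σ => by
    rw [measureReal_def, h.uniform]
    simp
  simp only [hreal]
  rw [← mul_sum]
  simp only [hg]
  rw [← sum_div, sum_sub_distrib, sum_add_distrib, ← mul_sum, sum_add_distrib, sum_add_distrib,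
    sum_card_layer_inter G hG I (i := 0) (by norm_num),
    sum_card_layer_inter G hG I (i := 1) (by norm_num),
    sum_card_layer_inter G hG I (i := 2) (by norm_num),
    sum_card_layer_inter G hG univ (i := 0) (by norm_num),
    sum_card_layer_inter G hG univ (i := 2) (by norm_num)]
  field_simp
  ring

end Probability

end PLG

theorem mainTheorem4 {V : Type*} [Fintype V] [DecidableEq V]
    (G : SimpleGraph V) [DecidableRel G.Adj] (hG : ∀ v : V, 2 ≤ G.degree v) :
    (∀ π : PLG.VertexOrder V, ∃ S : Finset V, PLG.PLGOutput G π S) ∧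
    (∀ (π : PLG.VertexOrder V) (S : Finset V), PLG.PLGOutput G π S →
      G.IsIndepSet (S : Set V)) ∧
    (∀ (Ω : Type*) [MeasurableSpace Ω] (μ : Measure Ω) [IsProbabilityMeasure μ]
      (π : Ω → PLG.VertexOrder V) (S : Ω → Finset V), PLG.IsExecution G μ π S →
      ∀ I : Finset V, G.IsIndepSet (I : Set V) →
        (15 / 7 : ℝ) * ∑ v ∈ I, 1 / ((G.degree v : ℝ) + 1) ≤ ∫ ω, ((S ω).card : ℝ) ∂μ) := by
  refine ⟨fun π => PLG.exists_plgOutput G π, fun π S h => h.isIndepSet, ?_⟩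
  intro Ω _ μ _ π S h I hI
  refine le_trans ?_ (h.integral_card_ge hG hI)
  refine mul_le_mul_of_nonneg_right (by norm_num) (Finset.sum_nonneg fun v _ => ?_)
  positivity
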